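/- Let $k$ be a field and $C$ a coalgebra over $k$ with comultiplication $\Delta(c)=\sum c_1\otimes c_2$ and counit $\varepsilon$. The dual space $C^*$ is an algebra under the convolution product $(fg)(c)=\sum f(c_1)g(c_2)$, with unit $\varepsilon$. A left $C$-comodule $M$, with structure map $\rho: M\to C\otimes M$, $\rho(m)=\sum m_{-1}\otimes m_0$, is a right $C^*$-module via $m\cdot f=\sum f(m_{-1})m_0$; in particular $C$ is a right $C^*$-module via $c\cdot f=\sum f(c_1)c_2$. The coalgebra $C$ is called *right co-Frobenius* if there is an injective morphism of right $C^*$-modules $C\to C^*$. A left $C$-comodule $(M,\rho)$ has *finite support* if there is a finite dimensional subspace $X\subseteq C$ with $\rho(M)\subseteq X\otimes M$; a right $C$-comodule $(N,\rho)$, $\rho:N\to N\otimes C$, has *finite support* if there is a finite dimensional subspace $X\subseteq C$ with $\rho(N)\subseteq N\otimes X$. For a left $C$-comodule $M$ let $\int_{l,C,M}$ be the $k$-space of all morphisms of left $C$-comodules $C\to M$, and for a right $C$-comodule $N$ let $\int_{r,C,N}$ be the $k$-space of all morphisms of right $C$-comodules $C\to N$, where $C$ is a left and right comodule over itself through $\Delta$.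 **Theorem.** Let $C$ be a right co-Frobenius coalgebra over $k$. Then, with dimensions over $k$ taken as cardinal numbers: 1. for every left $C$-comodule $M$ of finite support (not necessarily finite dimensional), $\dim \int_{l,C,M}\le \dim M$; 2. for every right $C$-comodule $N$ of finite support (not necessarily finite dimensional), $\dim N\le \dim \int_{r,C,N}$. -/

import Mathlib

open scoped TensorProduct

universe u v w w'

namespace CoFrobenius

/-- A left comodule over the `k`-coalgebra `C`: a `k`-module `M` with a coassociative and
counital structure map `ρ : M → C ⊗ M`. -/
class LeftComodule (k : Type u) (C : Type v) (M : Type w) [CommSemiring k]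
    [AddCommMonoid C] [Module k C] [Coalgebra k C] [AddCommMonoid M] [Module k M] where
  /-- the structure map `ρ : M → C ⊗ M` -/
  coact : M →ₗ[k] C ⊗[k] M
  /-- `(Δ ⊗ id) ∘ ρ = (id ⊗ ρ) ∘ ρ` -/
  coassoc : (TensorProduct.assoc k C C M).toLinearMap ∘ₗ
    (Coalgebra.comul (R := k) (A := C)).rTensor M ∘ₗ coact = coact.lTensor C ∘ₗ coact
  /-- `(ε ⊗ id) ∘ ρ = id`, under the identification `k ⊗ M = M` -/
  counit_coact : (TensorProduct.lid k M).toLinearMap ∘ₗ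
    (Coalgebra.counit (R := k) (A := C)).rTensor M ∘ₗ coact = LinearMap.id

/-- A right comodule over the `k`-coalgebra `C`: a `k`-module `N` with a coassociative and
counital structure map `ρ : N → N ⊗ C`. -/
class RightComodule (k : Type u) (C : Type v) (N : Type w) [CommSemiring k]
    [AddCommMonoid C] [Module k C] [Coalgebra k C] [AddCommMonoid N] [Module k N] where
  /-- the structure map `ρ : N → N ⊗ C` -/
  coact : N →ₗ[k] N ⊗[k] C
  /-- `(ρ ⊗ id) ∘ ρ = (id ⊗ Δ) ∘ ρ` -/
  coassoc : (TensorProduct.assoc k N C C).toLinearMap ∘ₗ coact.rTensor C ∘ₗ coact =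
    (Coalgebra.comul (R := k) (A := C)).lTensor N ∘ₗ coact
  /-- `(id ⊗ ε) ∘ ρ = id`, under the identification `N ⊗ k = N` -/
  counit_coact : (TensorProduct.rid k N).toLinearMap ∘ₗ
    (Coalgebra.counit (R := k) (A := C)).lTensor N ∘ₗ coact = LinearMap.id

section

variable (k : Type u) (C : Type v) [CommRing k] [AddCommGroup C] [Module k C] [Coalgebra k C]

/-- `C` is a left comodule over itself through `Δ`. -/
instance regularLeft : LeftComodule k C C where
  coact := Coalgebra.comul
  coassoc := Coalgebra.coassoc
  counit_coact := by
    ext c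
    simp

/-- `C` is a right comodule over itself through `Δ`. -/
instance regularRight : RightComodule k C C where
  coact := Coalgebra.comul
  coassoc := Coalgebra.coassoc
  counit_coact := by
    ext c
    simp

/-- The dual algebra `C^*`: linear forms on `C` with the convolution product
`(f * g) c = ∑ f c₁ * g c₂`, whose unit is the counit of `C`. -/
abbrev DualAlgebra : Type (max u v) := WithConv (C →ₗ[k] k)

/-- The right action of `C^*` on a left comodule: `m · f = ∑ f(m₋₁) m₀`. -/
noncomputable def rightAct {M : Type w} [AddCommGroup M] [Module k M] [LeftComodule k C M]
    (m : M) (f : DualAlgebra k C) : M :=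
  TensorProduct.lid k M (f.ofConv.rTensor M (LeftComodule.coact (C := C) m))

/-- `C` is right co-Frobenius if `C` embeds in `C^*` as a right `C^*`-module, where `C` carries
the action `c · f = ∑ f(c₁) c₂` and `C^*` acts on itself by right multiplication. -/
def IsRightCoFrobenius : Prop :=
  ∃ α : C →ₗ[k] DualAlgebra k C, Function.Injective α ∧
    ∀ (c : C) (f : DualAlgebra k C), α (rightAct k C c f) = α c * f

/-- The space of morphisms of left `C`-comodules from `M` to `M'`. -/
def leftComoduleHom (M : Type w) (M' : Type w') [AddCommGroup M] [Module k M]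
    [LeftComodule k C M] [AddCommGroup M'] [Module k M'] [LeftComodule k C M'] :
    Submodule k (M →ₗ[k] M') where
  carrier := {f | (LeftComodule.coact : M' →ₗ[k] C ⊗[k] M') ∘ₗ f =
    f.lTensor C ∘ₗ (LeftComodule.coact : M →ₗ[k] C ⊗[k] M)}
  add_mem' := by
    intro f g hf hg
    simp only [Set.mem_ofPred_eq] at hf hg ⊢
    rw [LinearMap.comp_add, LinearMap.lTensor_add, LinearMap.add_comp, hf, hg]
  zero_mem' := by simp
  smul_mem' := by
    intro a f hf
    simp only [Set.mem_ofPred_eq] at hf ⊢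
    rw [LinearMap.comp_smul, LinearMap.lTensor_smul, LinearMap.smul_comp, hf]

/-- The space of morphisms of right `C`-comodules from `N` to `N'`. -/
def rightComoduleHom (N : Type w) (N' : Type w') [AddCommGroup N] [Module k N]
    [RightComodule k C N] [AddCommGroup N'] [Module k N'] [RightComodule k C N'] :
    Submodule k (N →ₗ[k] N') where
  carrier := {f | (RightComodule.coact : N' →ₗ[k] N' ⊗[k] C) ∘ₗ f =
    f.rTensor C ∘ₗ (RightComodule.coact : N →ₗ[k] N ⊗[k] C)}
  add_mem' := by
    intro f g hf hg
    simp only [Set.mem_ofPred_eq] at hf hg ⊢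
    rw [LinearMap.comp_add, LinearMap.rTensor_add, LinearMap.add_comp, hf, hg]
  zero_mem' := by simp
  smul_mem' := by
    intro a f hf
    simp only [Set.mem_ofPred_eq] at hf ⊢
    rw [LinearMap.comp_smul, LinearMap.rTensor_smul, LinearMap.smul_comp, hf]

/-- The space of left `M`-integrals on `C`: the left comodule morphisms from `C` to `M`. -/
abbrev leftIntegrals (M : Type w) [AddCommGroup M] [Module k M] [LeftComodule k C M] :
    Submodule k (C →ₗ[k] M) :=
  leftComoduleHom k C C M

/-- The space of right `N`-integrals on `C`: the right comodule morphisms from `C` to `N`. -/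
abbrev rightIntegrals (N : Type w) [AddCommGroup N] [Module k N] [RightComodule k C N] :
    Submodule k (C →ₗ[k] N) :=
  rightComoduleHom k C C N

end

section

variable (k : Type u) (C : Type v) [Field k] [AddCommGroup C] [Module k C] [Coalgebra k C]

/-- A left comodule `M` has finite support if `ρ(M) ⊆ X ⊗ M` for some finite dimensional subspace
`X` of `C`. -/
def LeftFiniteSupport (M : Type w) [AddCommGroup M] [Module k M] [LeftComodule k C M] : Prop :=
  ∃ X : Submodule k C, FiniteDimensional k X ∧
    LinearMap.range (LeftComodule.coact : M →ₗ[k] C ⊗[k] M) ≤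
      LinearMap.range (X.subtype.rTensor M)

/-- A right comodule `N` has finite support if `ρ(N) ⊆ N ⊗ X` for some finite dimensional subspace
`X` of `C`. -/
def RightFiniteSupport (N : Type w) [AddCommGroup N] [Module k N] [RightComodule k C N] : Prop :=
  ∃ X : Submodule k C, FiniteDimensional k X ∧
    LinearMap.range (RightComodule.coact : N →ₗ[k] N ⊗[k] C) ≤
      LinearMap.range (X.subtype.lTensor N)

end

end CoFrobenius

/-! The embedding `C → C^*` amounts to a form `β` with no left kernel satisfying `∑ c₁ β(c₂, d) = ∑
β(c, d₁) d₂`. On a finite dimensional subspace of `C` the counit is some `β(-, x)`. For finitely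
supported `N` this makes `n ↦ (d ↦ ∑ n₀ β(n₁, d))` an embedding of `N` into its integrals
(`integralOf_mem`, `integralOf_injective`). It also puts any finite subset of `C` inside one cyclic
submodule `x · C^*` (`exists_generator`). A dimension argument then yields a single `x` at which
evaluation is injective on the integrals into `M` (`exists_separating`, `exists_eval_injective`). -/

namespace CoFrobenius

open TensorProduct

/-! ### Contracting tensors with linear forms -/

section Contractions

variable {k : Type*} [CommRing k] {V W U : Type*} [AddCommGroup V] [Module k V]
  [AddCommGroup W] [Module k W] [AddCommGroup U] [Module k U]

/-- Contraction of the left tensor factor with a linear form: `v ⊗ w ↦ f v • w`. -/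
noncomputable def contractL (f : V →ₗ[k] k) : V ⊗[k] W →ₗ[k] W :=
  (TensorProduct.lid k W).toLinearMap ∘ₗ f.rTensor W

/-- Contraction of the right tensor factor with a linear form: `v ⊗ w ↦ f w • v`. -/
noncomputable def contractR (f : W →ₗ[k] k) : V ⊗[k] W →ₗ[k] V :=
  (TensorProduct.rid k V).toLinearMap ∘ₗ f.lTensor V

@[simp]
theorem contractL_tmul (f : V →ₗ[k] k) (v : V) (w : W) : contractL f (v ⊗ₜ[k] w) = f v • w := by
  simp [contractL]

@[simp]
theorem contractR_tmul (f : W →ₗ[k] k) (v : V) (w : W) : contractR f (v ⊗ₜ[k] w) = f w • v := by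
  simp [contractR]

theorem contractL_lTensor (f : V →ₗ[k] k) (g : W →ₗ[k] U) (t : V ⊗[k] W) :
    contractL f (g.lTensor V t) = g (contractL f t) := by
  induction t with
  | zero => simp
  | tmul v w => simp
  | add s t hs ht => simp only [map_add, hs, ht]

theorem contractR_rTensor (f : W →ₗ[k] k) (g : V →ₗ[k] U) (t : V ⊗[k] W) :
    contractR f (g.rTensor W t) = g (contractR f t) := by
  induction t with
  | zero => simp
  | tmul v w => simp
  | add s t hs ht => simp only [map_add, hs, ht]

theorem apply_contractL (f : V →ₗ[k] k) (g : W →ₗ[k] k) (t : V ⊗[k] W) :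
    g (contractL f t) = f (contractR g t) := by
  induction t with
  | zero => simp
  | tmul v w => simp [mul_comm]
  | add s t hs ht => simp only [map_add, hs, ht]

theorem mul'_map_eq (f : V →ₗ[k] k) (g : W →ₗ[k] k) (t : V ⊗[k] W) :
    LinearMap.mul' k k (TensorProduct.map f g t) = g (contractL f t) := by
  induction t with
  | zero => simp
  | tmul v w => simp
  | add s t hs ht => simp only [map_add, hs, ht]

/-- Forms agreeing on `Y` give the same contraction on `V ⊗ Y`. -/
theorem contractR_congr {Y : Submodule k W} {f g : W →ₗ[k] k} (h : ∀ y ∈ Y, f y = g y)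
    {t : V ⊗[k] W} (ht : t ∈ LinearMap.range (Y.subtype.lTensor V)) :
    contractR f t = contractR g t := by
  obtain ⟨s, rfl⟩ := ht
  induction s with
  | zero => simp
  | tmul v y => simp [h y y.2]
  | add s t hs ht => simp only [map_add, hs, ht]

theorem contractR_mem {X : Submodule k V} (f : W →ₗ[k] k)
    {t : V ⊗[k] W} (ht : t ∈ LinearMap.range (X.subtype.rTensor W)) :
    contractR f t ∈ X := by
  obtain ⟨s, rfl⟩ := ht
  rw [contractR_rTensor]
  exact Subtype.prop _

end Contractions

/-! ### Comodule morphisms and balanced forms -/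

section Comodules

variable {k : Type u} {C : Type v} [CommRing k] [AddCommGroup C] [Module k C] [Coalgebra k C]

theorem contractR_counit_comul (c : C) :
    contractR (Coalgebra.counit (R := k)) (Coalgebra.comul (R := k) c) = c := by
  simp [contractR]

/-- Left comodule morphisms commute with the action of linear forms. -/
theorem leftComoduleHom_contractL {M : Type w} [AddCommGroup M] [Module k M] [LeftComodule k C M]
    {f : C →ₗ[k] M} (hf : f ∈ leftIntegrals k C M) (φ : C →ₗ[k] k) (x : C) :
    f (contractL φ (Coalgebra.comul (R := k) x)) =
      contractL φ (LeftComodule.coact (k := k) (C := C) (f x)) := by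
  rw [← contractL_lTensor]
  exact congrArg (contractL φ) (LinearMap.congr_fun hf x).symm

/-- For a linear form `μ` on a left comodule `M`, the coefficient map
`m ↦ ∑ m₋₁ μ(m₀)` is a morphism of left comodules `M → C`. -/
theorem comul_contractR_coact {M : Type w} [AddCommGroup M] [Module k M] [LeftComodule k C M]
    (μ : M →ₗ[k] k) (m : M) :
    Coalgebra.comul (R := k) (contractR μ (LeftComodule.coact (k := k) (C := C) m)) =
      (contractR μ ∘ₗ LeftComodule.coact (k := k) (C := C)).lTensor C
        (LeftComodule.coact (k := k) (C := C) m) := by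
  have h := LinearMap.congr_fun (LeftComodule.coassoc (k := k) (C := C) (M := M)) m
  simp only [LinearMap.comp_apply, LinearEquiv.coe_coe] at h
  rw [LinearMap.lTensor_comp_apply, ← h, ← contractR_rTensor]
  generalize (Coalgebra.comul (R := k) (A := C)).rTensor M
    (LeftComodule.coact (k := k) (C := C) m) = t
  induction t with
  | zero => simp
  | tmul s m =>
    induction s with
    | zero => simp
    | tmul a b => simp [TensorProduct.tmul_smul]
    | add s t hs ht => simp only [map_add, hs, ht, TensorProduct.add_tmul]
  | add s t hs ht => simp only [map_add, hs, ht]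

/-- Composing an `M`-integral with the coefficient map of a linear form on `M`. -/
theorem contractR_comp_mem_leftIntegrals {M : Type w} [AddCommGroup M] [Module k M]
    [LeftComodule k C M] {f : C →ₗ[k] M} (hf : f ∈ leftIntegrals k C M) (μ : M →ₗ[k] k) :
    contractR μ ∘ₗ LeftComodule.coact (k := k) (C := C) ∘ₗ f ∈ leftIntegrals k C C := by
  change _ = _
  ext c
  have h : LeftComodule.coact (k := k) (C := C) (f c) = f.lTensor C (Coalgebra.comul (R := k) c) :=
    LinearMap.congr_fun hf c
  change Coalgebra.comul (R := k) (contractR μ (LeftComodule.coact (k := k) (C := C) (f c))) =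
    (contractR μ ∘ₗ LeftComodule.coact (k := k) (C := C) ∘ₗ f).lTensor C
      (Coalgebra.comul (R := k) c)
  rw [comul_contractR_coact, ← LinearMap.comp_assoc, LinearMap.lTensor_comp_apply _ _ f, ← h]

/-- No information is lost in passing from `M` to `C`: the counit recovers `μ` from its coefficient
map. -/
theorem counit_contractR_coact {M : Type w} [AddCommGroup M] [Module k M] [LeftComodule k C M]
    (μ : M →ₗ[k] k) (m : M) :
    Coalgebra.counit (R := k) (contractR μ (LeftComodule.coact (k := k) (C := C) m)) = μ m := by
  rw [← apply_contractL]
  exact congrArg μ (LinearMap.congr_fun (LeftComodule.counit_coact (k := k) (C := C) (M := M)) m)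

/-- A bilinear form `β` on `C` is balanced if `∑ c₁ β(c₂, d) = ∑ β(c, d₁) d₂`. -/
def IsBalanced (β : C →ₗ[k] C →ₗ[k] k) : Prop :=
  ∀ c d : C, contractR (β.flip d) (Coalgebra.comul (R := k) c) =
    contractL (β c) (Coalgebra.comul (R := k) d)

/-- The map `d ↦ ∑ n₀ β(n₁, d)` attached to an element `n` of a right comodule. -/
noncomputable def integralOf {N : Type w} [AddCommGroup N] [Module k N] [RightComodule k C N]
    (β : C →ₗ[k] C →ₗ[k] k) : N →ₗ[k] C →ₗ[k] N :=
  LinearMap.mk₂ k (fun n d => contractR (β.flip d) (RightComodule.coact (k := k) (C := C) n))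
    (by simp) (by simp)
    (by simp [contractR, LinearMap.lTensor_add]) (by simp [contractR, LinearMap.lTensor_smul])

theorem integralOf_apply {N : Type w} [AddCommGroup N] [Module k N] [RightComodule k C N]
    (β : C →ₗ[k] C →ₗ[k] k) (n : N) (d : C) :
    integralOf β n d = contractR (β.flip d) (RightComodule.coact (k := k) (C := C) n) := rfl

/-- By coassociativity, coacting on the value gives `∑ n₀ ⊗ n₁ β(n₂, d)`, and balance turns this
into `∑ n₀ β(n₁, d₁) ⊗ d₂`. -/
theorem IsBalanced.integralOf_mem {N : Type w} [AddCommGroup N] [Module k N] [RightComodule k C N]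
    {β : C →ₗ[k] C →ₗ[k] k} (hβ : IsBalanced β) (n : N) :
    integralOf β n ∈ rightIntegrals k C N := by
  change _ = _
  ext d
  change RightComodule.coact (k := k) (C := C) (integralOf β n d) =
    (integralOf β n).rTensor C (Coalgebra.comul (R := k) d)
  have h := LinearMap.congr_fun (RightComodule.coassoc (k := k) (C := C) (N := N)) n
  simp only [LinearMap.comp_apply, LinearEquiv.coe_coe] at h
  have hl : RightComodule.coact (k := k) (C := C) (integralOf β n d) =
      (contractR (β.flip d) ∘ₗ Coalgebra.comul (R := k)).lTensor N
        (RightComodule.coact (k := k) (C := C) n) := by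
    rw [LinearMap.lTensor_comp_apply, ← h, integralOf_apply, ← contractR_rTensor]
    generalize (RightComodule.coact (k := k) (C := C) (N := N)).rTensor C
      (RightComodule.coact (k := k) (C := C) n) = t
    induction t with
    | zero => simp
    | tmul s m =>
      induction s with
      | zero => simp
      | tmul a b => simp [TensorProduct.tmul_smul]
      | add s t hs ht => simp only [map_add, hs, ht, TensorProduct.add_tmul]
    | add s t hs ht => simp only [map_add, hs, ht]
  -- `L (a ⊗ b)` is `c ↦ β(c, a) b`; with it, both sides become a map `C → C` applied to the right
  -- factor of `ρ(n)`.
  let L : C ⊗[k] C →ₗ[k] C →ₗ[k] C :=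
    (LinearMap.mk₂ k (fun c s => contractL (β c) s)
      (by simp [contractL, LinearMap.rTensor_add]) (by simp [contractL, LinearMap.rTensor_smul])
      (by simp) (by simp)).flip
  have hr (s : C ⊗[k] C) : (integralOf β n).rTensor C s =
      (L s).lTensor N (RightComodule.coact (k := k) (C := C) n) := by
    induction s with
    | zero => simp
    | tmul a b =>
      rw [LinearMap.rTensor_tmul, integralOf_apply]
      generalize RightComodule.coact (k := k) (C := C) n = t
      induction t with
      | zero => simp
      | tmul m c =>
        have hc : L (a ⊗ₜ[k] b) c = β c a • b := contractL_tmul _ _ _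
        rw [LinearMap.lTensor_tmul, hc, contractR_tmul, LinearMap.flip_apply,
          TensorProduct.smul_tmul]
      | add s t hs ht => simp only [map_add, hs, ht, TensorProduct.add_tmul]
    | add s t hs ht => simp only [map_add, hs, ht, LinearMap.lTensor_add, LinearMap.add_apply]
  have hL : contractR (β.flip d) ∘ₗ Coalgebra.comul (R := k) = L (Coalgebra.comul (R := k) d) :=
    LinearMap.ext fun c => hβ c d
  rw [hl, hr, hL]

end Comodules

/-! ### Consequences of the co-Frobenius form over a field -/

section Field

variable {k : Type u} {C : Type v} [Field k] [AddCommGroup C] [Module k C] [Coalgebra k C]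

/-- A right co-Frobenius coalgebra carries a balanced bilinear form without left kernel. -/
theorem IsRightCoFrobenius.exists_balanced (hC : IsRightCoFrobenius k C) :
    ∃ β : C →ₗ[k] C →ₗ[k] k, Function.Injective β ∧ IsBalanced β := by
  obtain ⟨α, hα, h⟩ := hC
  refine ⟨(WithConv.linearEquiv k (C →ₗ[k] k)).toLinearMap ∘ₗ α,
    (WithConv.linearEquiv k (C →ₗ[k] k)).injective.comp hα, fun c d => ?_⟩
  -- Tested against a linear form `f`, balance is `α(c · f) = α(c) * f` evaluated at `d`.
  rw [← sub_eq_zero, ← Module.forall_dual_apply_eq_zero_iff k]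
  intro f
  rw [map_sub, sub_eq_zero, ← apply_contractL]
  exact (congrArg (fun g : DualAlgebra k C => g.ofConv d) (h c (WithConv.toConv f))).trans
    (mul'_map_eq _ _ _)

/-- A bilinear form without left kernel represents the counit on every finite dimensional
subspace. -/
theorem exists_eq_counit_on {β : C →ₗ[k] C →ₗ[k] k} (hβ : Function.Injective β)
    (Y : Submodule k C) [FiniteDimensional k Y] :
    ∃ x : C, ∀ y ∈ Y, β.flip x y = Coalgebra.counit (R := k) y := by
  have hinj : Function.Injective (β ∘ₗ Y.subtype) := hβ.comp Y.subtype_injective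
  -- As `Y` is finite dimensional, injectivity of `Y → C^*` makes the transposed map `C → Y^*`
  -- surjective.
  obtain ⟨x, hx⟩ := LinearMap.flip_surjective_iff₁.mpr hinj
    ((Coalgebra.counit (R := k)) ∘ₗ Y.subtype)
  exact ⟨x, fun y hy => LinearMap.congr_fun hx ⟨y, hy⟩⟩

/-- Finitely many elements of `C` lie in a common cyclic `C^*`-submodule. -/
theorem IsBalanced.exists_generator {β : C →ₗ[k] C →ₗ[k] k} (hb : IsBalanced β)
    (hβ : Function.Injective β) (s : Set C) (hs : s.Finite) :
    ∃ x : C, ∀ c ∈ s, contractL (β c) (Coalgebra.comul (R := k) x) = c := by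
  obtain ⟨Y, hY, hsub⟩ := TensorProduct.exists_finite_submodule_right_of_setFinite
    ((fun c => Coalgebra.comul (R := k) c) '' s) (hs.image _)
  obtain ⟨x, hx⟩ := exists_eq_counit_on hβ Y
  refine ⟨x, fun c hc => ?_⟩
  -- `∑ β(c, x₁) x₂ = ∑ c₁ β(c₂, x) = ∑ c₁ ε(c₂) = c`.
  rw [← hb c x, contractR_congr hx (hsub ⟨c, hc, rfl⟩), contractR_counit_comul]

/-- Endomorphisms of the left comodule `C` with values in a fixed finite dimensional subspace are
determined by their value at a single element. -/
theorem IsBalanced.exists_separating {β : C →ₗ[k] C →ₗ[k] k} (hb : IsBalanced β)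
    (hβ : Function.Injective β) (X : Submodule k C) [FiniteDimensional k X] :
    ∃ x : C, ∀ f ∈ leftIntegrals k C C, LinearMap.range f ≤ X → f x = 0 → f = 0 := by
  let H : Submodule k (C →ₗ[k] C) :=
    { carrier := {f | f ∈ leftIntegrals k C C ∧ ∀ c, f c ∈ X}
      add_mem' := fun hf hg => ⟨add_mem hf.1 hg.1, fun c => X.add_mem (hf.2 c) (hg.2 c)⟩
      zero_mem' := ⟨zero_mem _, fun c => X.zero_mem⟩
      smul_mem' := fun a f hf => ⟨Submodule.smul_mem _ a hf.1, fun c => X.smul_mem a (hf.2 c)⟩ }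
  let E (x : C) : Submodule k C := H.map (LinearMap.applyₗ x)
  have hE (x : C) : E x ≤ X := by
    rintro _ ⟨f, hf, rfl⟩
    exact hf.2 x
  -- The codimension in `X` of the space of values at `x`; minimizing it maximizes `dim E x`.
  let r (x : C) : ℕ := Module.finrank k X - Module.finrank k (E x)
  let x := Function.argmin r
  refine ⟨x, fun f hf hfX hfx => ?_⟩
  by_contra hne
  obtain ⟨c, hc⟩ : ∃ c, f c ≠ 0 := by
    by_contra! h
    exact hne (LinearMap.ext h)
  obtain ⟨y, hy⟩ := hb.exists_generator hβ {x, c} (by simp)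
  have hval (g : C →ₗ[k] C) (hg : g ∈ leftIntegrals k C C) (z : C) (hz : z ∈ ({x, c} : Set C)) :
      g z = contractL (β z) (Coalgebra.comul (R := k) (g y)) := by
    conv_lhs => rw [← hy z hz]
    exact leftComoduleHom_contractL hg (β z) y
  have hfH : f ∈ H := ⟨hf, fun c => hfX ⟨c, rfl⟩⟩
  have : FiniteDimensional k (E y) := Submodule.finiteDimensional_of_le (hE y)
  -- Acting by `β x` carries `g y` to `g x`, so `A` covers `E x` and kills `f y`, which is nonzero
  -- since `f c ≠ 0`. Hence `dim E y > dim E x`, against the choice of `x`.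
  let A : E y →ₗ[k] C := (contractL (β x) ∘ₗ Coalgebra.comul (R := k)).domRestrict (E y)
  have hrange : E x ≤ LinearMap.range A := by
    rintro _ ⟨g, hg, rfl⟩
    exact ⟨⟨g y, g, hg, rfl⟩, (hval g hg.1 x (by simp)).symm⟩
  have hker : 0 < Module.finrank k (LinearMap.ker A) := by
    rw [Module.finrank_pos_iff_exists_ne_zero]
    refine ⟨⟨⟨f y, f, hfH, rfl⟩, ?_⟩, fun h => hc ?_⟩
    · exact (hval f hf x (by simp)).symm.trans hfx
    · have h0 : f y = 0 := congrArg (fun z : LinearMap.ker A => ((z : E y) : C)) h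
      rw [hval f hf c (by simp), h0, map_zero, map_zero]
  have h1 := LinearMap.finrank_range_add_finrank_ker A
  have h2 := Submodule.finrank_mono hrange
  have h3 := Submodule.finrank_mono (hE y)
  have h4 : r x ≤ r y := Function.argmin_le r y
  simp only [r] at h4
  omega

/-- An integral with values in a comodule of finite support is determined by its value at a
single element, chosen independently of the integral. -/
theorem IsBalanced.exists_eval_injective {β : C →ₗ[k] C →ₗ[k] k} (hb : IsBalanced β)
    (hβ : Function.Injective β) {M : Type w} [AddCommGroup M] [Module k M] [LeftComodule k C M]
    (hM : LeftFiniteSupport k C M) :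
    ∃ x : C, Function.Injective (LinearMap.applyₗ x ∘ₗ (leftIntegrals k C M).subtype) := by
  obtain ⟨X, hX, hρ⟩ := hM
  obtain ⟨x, hx⟩ := hb.exists_separating hβ X
  refine ⟨x, (injective_iff_map_eq_zero _).mpr ?_⟩
  rintro ⟨f, hf⟩ (hfx : f x = 0)
  refine Subtype.ext (LinearMap.ext fun c => (Module.forall_dual_apply_eq_zero_iff k _).mp ?_)
  intro μ
  -- The coefficient map of `μ` lands in `X`, whatever the dimension of `M`, so one `x` serves every
  -- `μ` and `f`.
  have h := hx _ (contractR_comp_mem_leftIntegrals hf μ) ?_ ?_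
  · have hc := congrArg (Coalgebra.counit (R := k)) (LinearMap.congr_fun h c)
    rw [LinearMap.zero_apply, map_zero] at hc
    exact (counit_contractR_coact μ (f c)).symm.trans hc
  · rintro _ ⟨c, rfl⟩
    exact contractR_mem μ (hρ ⟨f c, rfl⟩)
  · simp [hfx]

/-- If `β(-, x)` is the counit on the support of `N`, evaluating at `x` returns `n`. -/
theorem integralOf_injective {β : C →ₗ[k] C →ₗ[k] k} (hβ : Function.Injective β)
    {N : Type w} [AddCommGroup N] [Module k N] [RightComodule k C N]
    (hN : RightFiniteSupport k C N) :
    Function.Injective (integralOf (N := N) β) := by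
  obtain ⟨X, hX, hρ⟩ := hN
  obtain ⟨x, hx⟩ := exists_eq_counit_on hβ X
  refine (injective_iff_map_eq_zero _).mpr fun n hn => ?_
  have h := LinearMap.congr_fun hn x
  rw [integralOf_apply, contractR_congr hx (hρ ⟨n, rfl⟩)] at h
  exact (LinearMap.congr_fun (RightComodule.counit_coact (k := k) (C := C) (N := N)) n).symm.trans h

end Field

end CoFrobenius

theorem mainTheorem1 {k : Type u} [Field k] {C : Type v} [AddCommGroup C] [Module k C]
    [Coalgebra k C] (hC : CoFrobenius.IsRightCoFrobenius k C) :
    (∀ (M : Type w) [AddCommGroup M] [Module k M] [CoFrobenius.LeftComodule k C M],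
      CoFrobenius.LeftFiniteSupport k C M →
        Module.rank k (CoFrobenius.leftIntegrals k C M) ≤
          Cardinal.lift.{v} (Module.rank k M)) ∧
    (∀ (N : Type w') [AddCommGroup N] [Module k N] [CoFrobenius.RightComodule k C N],
      CoFrobenius.RightFiniteSupport k C N →
        Cardinal.lift.{v} (Module.rank k N) ≤
          Module.rank k (CoFrobenius.rightIntegrals k C N)) := by
  obtain ⟨β, hβ, hb⟩ := hC.exists_balanced
  refine ⟨fun M _ _ _ hM => ?_, fun N _ _ _ hN => ?_⟩
  · obtain ⟨x, hx⟩ := hb.exists_eval_injective hβ hM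
    have h := LinearMap.lift_rank_le_of_injective _ hx
    rwa [Cardinal.lift_id'.{w, max v w}, Cardinal.lift_umax.{w, v}] at h
  · have h := LinearMap.lift_rank_le_of_injective
      ((CoFrobenius.integralOf β).codRestrict (CoFrobenius.rightIntegrals k C N)
        hb.integralOf_mem)
      ((LinearMap.injective_codRestrict_iff _).mpr (CoFrobenius.integralOf_injective hβ hN))
    rwa [Cardinal.lift_id'.{w', max v w'}, Cardinal.lift_umax.{w', v}] at h
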